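/- All Banach spaces are real. For a Banach space $Y$ let $\operatorname{cof}(Y)$ be the set of closed subspaces of $Y$ of finite codimension. For $y \in Y$ with $\|y\|=1$ and $t>0$, put $$\tilde\delta_Y(y,t)=\sup_{E\in\operatorname{cof}(Y)}\ \inf_{z\in E,\ \|z\|=1}\max\{\|y+tz\|,\|y-tz\|\}-1 .$$ $Y$ is called locally asymptotically midpoint uniformly convex (locally AMUC) if $\tilde\delta_Y(y,t)>0$ for every $y$ with $\|y\|=1$ and every $t>0$. A bounded operator $T:X\to Y$ is norm-attaining if $\|Tx\|=\|T\|$ for some $x$ with $\|x\|\le 1$, and $Y$ has (Lindenstrauss') property B if, for every Banach space $X$, the norm-attaining operators are norm-dense in the space $\mathcal L(X,Y)$ of bounded linear operators. A basic sequence is an infinite sequence $(y_n)_{n\in\mathbb N}$ that is a Schauder basis of its closed linear span; two basic sequences $(x_n)$, $(z_n)$ are equivalent if, for all scalars $(a_n)$, the series $\sum a_nx_n$ converges if and only if $\sum a_nz_n$ converges; a basic sequence $(y_n)$ is symmetric if for every permutation $\sigma$ of $\mathbb N$ the sequence $(y_{\sigma(n)})$ is a basis of the same closed linear span, equivalent to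 $(y_n)$. **Theorem.** Let $Y$ be a locally AMUC Banach space which has a normalized, symmetric basic sequence $(y_n)_{n\in\mathbb N}$ (normalized: $\|y_n\|=1$ for all $n$) that is not equivalent to the unit vector basis of $\ell_1$. Then $Y$ fails property B. -/

import Mathlib

open Filter Topology

universe u v

noncomputable section

/-- The closed subspaces of `Y` of finite codimension. -/
def cof (Y : Type*) [NormedAddCommGroup Y] [NormedSpace ℝ Y] : Set (Submodule ℝ Y) :=
  {E | IsClosed (E : Set Y) ∧ FiniteDimensional ℝ (Y ⧸ E)}

/-- The modulus `sup_{E ∈ cof(Y)} inf_{z ∈ S_E} max (‖y + t z‖) (‖y - t z‖) - 1`, with values in the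
extended reals (so that the infimum over an empty sphere is `⊤`). -/
def amucModulus {Y : Type*} [NormedAddCommGroup Y] [NormedSpace ℝ Y] (y : Y) (t : ℝ) : EReal :=
  (⨆ E ∈ cof Y, ⨅ z ∈ {z : Y | z ∈ E ∧ ‖z‖ = 1},
    ((max ‖y + t • z‖ ‖y - t • z‖ : ℝ) : EReal)) - 1

/-- Locally asymptotically midpoint uniformly convex spaces. -/
def IsLocallyAMUC (Y : Type*) [NormedAddCommGroup Y] [NormedSpace ℝ Y] : Prop :=
  ∀ y : Y, ‖y‖ = 1 → ∀ t : ℝ, 0 < t → 0 < amucModulus y t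

/-- The set of norm-attaining bounded operators from `X` to `Y`. -/
def normAttaining (X : Type*) (Y : Type*) [NormedAddCommGroup X] [NormedSpace ℝ X]
    [NormedAddCommGroup Y] [NormedSpace ℝ Y] : Set (X →L[ℝ] Y) :=
  {T | ∃ x : X, ‖x‖ ≤ 1 ∧ ‖T x‖ = ‖T‖}

/-- Lindenstrauss' property B, tested on the real Banach spaces `X` of the universe `v`. -/
def HasPropertyB (Y : Type u) [NormedAddCommGroup Y] [NormedSpace ℝ Y] : Prop :=
  ∀ (X : Type v) [NormedAddCommGroup X] [NormedSpace ℝ X] [CompleteSpace X],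
    Dense (normAttaining X Y)

/-- The sequence `x` is a (Schauder) basis of `X`. -/
def IsBasisSeq {X : Type*} [NormedAddCommGroup X] [NormedSpace ℝ X] (x : ℕ → X) : Prop :=
  ∃ b : SchauderBasis ℝ X, ∀ n, b n = x n

/-- The series `∑ xₙ` converges, in the sense of partial sums. -/
def SeriesConverges {X : Type*} [NormedAddCommGroup X] (x : ℕ → X) : Prop :=
  ∃ s : X, Tendsto (fun N => ∑ n ∈ Finset.range N, x n) atTop (𝓝 s)

/-- Equivalence of sequences (used for basic sequences): `∑ aₙ xₙ` converges if and only if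
`∑ aₙ zₙ` converges, for all scalars `aₙ`. -/
def EquivSeq {X Z : Type*} [NormedAddCommGroup X] [NormedSpace ℝ X]
    [NormedAddCommGroup Z] [NormedSpace ℝ Z] (x : ℕ → X) (z : ℕ → Z) : Prop :=
  ∀ a : ℕ → ℝ, SeriesConverges (fun n => a n • x n) ↔ SeriesConverges (fun n => a n • z n)

/-- A symmetric basis: every permutation of it is a basis equivalent to it. -/
def IsSymmetricBasis {X : Type*} [NormedAddCommGroup X] [NormedSpace ℝ X] (x : ℕ → X) : Prop :=
  IsBasisSeq x ∧ ∀ σ : Equiv.Perm ℕ, IsBasisSeq (x ∘ σ) ∧ EquivSeq (x ∘ σ) x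

/-- The closed linear span of a sequence. -/
def closedSpan {Y : Type*} [NormedAddCommGroup Y] [NormedSpace ℝ Y] (y : ℕ → Y) :
    Submodule ℝ Y :=
  (Submodule.span ℝ (Set.range y)).topologicalClosure

/-- The sequence `y`, seen in its closed linear span. -/
def toClosedSpan {Y : Type*} [NormedAddCommGroup Y] [NormedSpace ℝ Y] (y : ℕ → Y) (n : ℕ) :
    closedSpan y :=
  ⟨y n, Submodule.le_topologicalClosure _ (Submodule.subset_span ⟨n, rfl⟩)⟩

/-- A symmetric basic sequence: a symmetric basis of its closed linear span. -/
def IsSymmetricBasicSequence {Y : Type*} [NormedAddCommGroup Y] [NormedSpace ℝ Y]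
    (y : ℕ → Y) : Prop :=
  IsSymmetricBasis (toClosedSpan y)

/-- The unit vector basis of `ℓ₁`. -/
def l1UnitVector (n : ℕ) : lp (fun _ : ℕ => ℝ) 1 :=
  lp.single 1 n (1 : ℝ)

end

/-! The obstruction pairs a domain whose unit ball is flat around each of its points with a range
that tolerates no such flatness. Symmetry and non-equivalence to ℓ₁ force the averages of a tail `z`
of the sequence over large finite sets to tend to 0 uniformly (`exists_seq_small_averages`), so that
‖∑_{i ∈ F} z i‖ ≤ |F| r(|F|)² for some r strictly decreasing to 0 (`exists_rate`).

Let X be the closed span of unit vectors e n under the norm sup_A r(|A|) |∑_{i ∈ A} xᵢ|. Summation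
by parts gives a bounded T : X → Y with T (e n) = z n (`exists_operator_flatVec`). Each x in the
unit ball of X is the midpoint of segments of one fixed length in all directions e n with n large,
inside the ball (`exists_norm_add_smul_flatVec_le_one`).

If S ≠ 0 attains its norm at x, these segments are mapped to segments around S x / ‖S‖ in the unit
ball of Y. The averages of e n vanish too, so S (e n) → 0 modulo every finite-codimensional
subspace, and local AMUC prevents ‖S (e n)‖ from being bounded below
(`IsLocallyAMUC.exists_norm_map_lt`). Since ‖T (e n)‖ = 1, T is not a limit of norm-attaining
operators. -/

/-! ### Gluing injections on consecutive blocks into one permutation. -/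

theorem exists_block_index (N : ℕ → ℕ) (h0 : N 0 = 0) (hN : StrictMono N) :
    ∃ κ : ℕ → ℕ, ∀ n k, κ n = k ↔ N k ≤ n ∧ n < N (k + 1) := by
  have hex : ∀ n, ∃ k, n < N (k + 1) := fun n =>
    ⟨n, lt_of_lt_of_le (Nat.lt_succ_self n) (hN.id_le (n + 1))⟩
  classical
  refine ⟨fun n => Nat.find (hex n), fun n k => ?_⟩
  rw [Nat.find_eq_iff]
  constructor
  · rintro ⟨h1, h2⟩
    refine ⟨?_, h1⟩
    rcases k with _ | k
    · omega
    · exact not_lt.mp (h2 k (Nat.lt_succ_self k))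
  · rintro ⟨h1, h2⟩
    exact ⟨h2, fun m hm => not_lt.mpr ((hN.monotone hm).trans h1)⟩

/-- Injections on finite sets, given on disjoint consecutive intervals, extend to one
permutation. -/
theorem exists_perm_extending_blocks (N : ℕ → ℕ) (h0 : N 0 = 0) (hN : StrictMono N)
    (p : ℕ → ℕ) (f g : ∀ k, Fin (p k) → ℕ)
    (hf : ∀ k, Function.Injective (f k)) (hg : ∀ k, Function.Injective (g k))
    (hfN : ∀ k j, N k ≤ f k j ∧ f k j < N (k + 1))
    (hgN : ∀ k j, N k ≤ g k j ∧ g k j < N (k + 1)) :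
    ∃ π : Equiv.Perm ℕ, ∀ k j, π (f k j) = g k j := by
  obtain ⟨κ, hκ⟩ := exists_block_index N h0 hN
  have hfin : ∀ k, Finite {n // κ n = k} := fun k =>
    Set.Finite.subset (Set.finite_Iio (N (k + 1))) (fun n hn => ((hκ n k).1 hn).2)
  have hσ : ∀ k, ∃ σ : Equiv.Perm {n // κ n = k},
      ∀ j, σ ⟨f k j, (hκ _ _).2 (hfN k j)⟩ = ⟨g k j, (hκ _ _).2 (hgN k j)⟩ := by
    intro k
    have := hfin k
    obtain ⟨σ, h⟩ := Equiv.Perm.exists_extending_pair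
      (fun j => (⟨f k j, (hκ _ _).2 (hfN k j)⟩ : {n // κ n = k}))
      (fun j => (⟨g k j, (hκ _ _).2 (hgN k j)⟩ : {n // κ n = k}))
      (fun i j hij => hf k (by simpa using hij)) (fun i j hij => hg k (by simpa using hij))
    exact ⟨σ, fun j => h j⟩
  choose σ hσ using hσ
  refine ⟨(Equiv.sigmaFiberEquiv κ).permCongr (Equiv.sigmaCongrRight σ), fun k j => ?_⟩
  have h1 : (Equiv.sigmaFiberEquiv κ).symm (f k j) = ⟨k, ⟨f k j, (hκ _ _).2 (hfN k j)⟩⟩ := by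
    rw [Equiv.symm_apply_eq]; rfl
  rw [Equiv.permCongr_apply, h1, Equiv.sigmaCongrRight_apply]
  simp only [hσ]
  rfl

/-! ### The symmetry constant of a basis. -/

section SchauderBasis

variable {X : Type*} [NormedAddCommGroup X] [NormedSpace ℝ X]

theorem SchauderBasis.coord_basis (b : SchauderBasis ℝ X) (i j : ℕ) :
    b.coord i (b j) = if i = j then 1 else 0 := by
  have h := b.ortho i j
  split_ifs with hij
  · subst hij
    exact h.trans (by simp)
  · exact h.trans (by simp [hij])

theorem SchauderBasis.seriesConverges_coord (b : SchauderBasis ℝ X) (x : X) :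
    SeriesConverges (fun n => b.coord n x • b n) :=
  ⟨x, by simpa using b.tendsto_proj x⟩

/-- The uniform symmetry constant of a basis, on a tail. -/
theorem SchauderBasis.exists_symmetric_bound [CompleteSpace X] (b : SchauderBasis ℝ X)
    (hsym : ∀ (σ : Equiv.Perm ℕ) (a : ℕ → ℝ), SeriesConverges (fun n => a n • b n) →
      SeriesConverges (fun n => a n • b (σ n))) :
    ∃ (N : ℕ) (K : ℝ), ∀ (p : ℕ) (f g : Fin p → ℕ), Function.Injective f → Function.Injective g →
      (∀ j, N ≤ f j) → (∀ j, N ≤ g j) → ∀ c : Fin p → ℝ,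
      ‖∑ j, c j • b (g j)‖ ≤ K * ‖∑ j, c j • b (f j)‖ := by
  -- Gliding hump: if every tail admits arbitrarily bad pairs `f`, `g`, pick such pairs on
  -- successive disjoint blocks, normalized so that the `g`-sum has norm 1 and the `f`-sum norm at
  -- most 2⁻ᵏ.
  by_contra! H
  have H' : ∀ N k : ℕ, ∃ (M p : ℕ) (f g : Fin p → ℕ) (c : Fin p → ℝ), N < M ∧
      Function.Injective f ∧ Function.Injective g ∧ (∀ j, N ≤ f j ∧ f j < M) ∧
      (∀ j, N ≤ g j ∧ g j < M) ∧ ‖∑ j, c j • b (g j)‖ = 1 ∧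
      ‖∑ j, c j • b (f j)‖ ≤ (1 / 2) ^ k := by
    intro N k
    obtain ⟨p, f, g, hf, hg, hfN, hgN, c, hc⟩ := H N (2 ^ k)
    have hpos : 0 < ‖∑ j, c j • b (g j)‖ := lt_of_le_of_lt (by positivity) hc
    set t := ‖∑ j, c j • b (g j)‖ with ht
    refine ⟨N + 1 + ∑ j, f j + ∑ j, g j, p, f, g, fun j => t⁻¹ * c j, by omega, hf, hg,
      fun j => ⟨hfN j, ?_⟩, fun j => ⟨hgN j, ?_⟩, ?_, ?_⟩
    · have := Finset.single_le_sum (f := f) (fun i _ => Nat.zero_le _) (Finset.mem_univ j)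
      omega
    · have := Finset.single_le_sum (f := g) (fun i _ => Nat.zero_le _) (Finset.mem_univ j)
      omega
    · simp only [mul_smul, ← Finset.smul_sum, norm_smul, ← ht]
      rw [norm_inv, Real.norm_of_nonneg hpos.le]
      exact inv_mul_cancel₀ hpos.ne'
    · simp only [mul_smul, ← Finset.smul_sum, norm_smul]
      rw [norm_inv, Real.norm_of_nonneg hpos.le, inv_mul_le_iff₀ hpos, one_div, inv_pow,
        ← div_eq_mul_inv, le_div_iff₀ (by positivity), mul_comm]
      exact hc.le
  choose M p f g c hNM hf hg hfM hgM hgc hfc using H'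
  let N : ℕ → ℕ := fun k => Nat.rec 0 (fun k n => M n k) k
  have hNs : ∀ k, N (k + 1) = M (N k) k := fun k => rfl
  have hN : StrictMono N := strictMono_nat_of_lt_succ fun k => by rw [hNs]; exact hNM _ _
  obtain ⟨π, hπ⟩ := exists_perm_extending_blocks N rfl hN (fun k => p (N k) k)
    (fun k => f (N k) k) (fun k => g (N k) k) (fun k => hf _ _) (fun k => hg _ _)
    (fun k => hfM _ _) (fun k => hgM _ _)
  -- The small `f`-sums add up to a vector whose coordinates on block k are exactly the coefficients
  -- of the k-th sum, the blocks being disjoint.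
  let x : ℕ → X := fun k => ∑ j, c (N k) k j • b (f (N k) k j)
  have hx : Summable x := Summable.of_norm_bounded
    (summable_geometric_of_lt_one (by norm_num) (by norm_num)) (fun k => hfc (N k) k)
  have hcoord : ∀ k i, N k ≤ i → i < N (k + 1) →
      b.coord i (∑' k, x k) = ∑ j, if i = f (N k) k j then c (N k) k j else 0 := by
    intro k i h1 h2
    rw [(b.coord i).map_tsum hx, tsum_eq_single k]
    · simp [x, SchauderBasis.coord_basis]
    · intro l hl
      simp only [x, map_sum, map_smul, SchauderBasis.coord_basis]
      refine Finset.sum_eq_zero fun j _ => ?_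
      rw [if_neg, smul_zero]
      rintro rfl
      have h3 := hfM (N l) l j
      rw [← hNs] at h3
      rcases lt_or_gt_of_ne hl with h | h
      · have := hN.monotone (Nat.succ_le_of_lt h)
        simp only [Nat.succ_eq_add_one] at this
        omega
      · have := hN.monotone (Nat.succ_le_of_lt h)
        simp only [Nat.succ_eq_add_one] at this
        omega
  -- After permuting by `π`, the k-th block of the series is the `g`-sum of norm 1, so the partial
  -- sums are not Cauchy.
  obtain ⟨s, hs⟩ := hsym π _ (b.seriesConverges_coord (∑' k, x k))
  have h1 := (hs.comp (hN.tendsto_atTop.comp (tendsto_add_atTop_nat 1))).sub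
    (hs.comp hN.tendsto_atTop)
  rw [sub_self] at h1
  have h2 : ∀ k, ‖(∑ n ∈ Finset.range (N (k + 1)), b.coord n (∑' k, x k) • b (π n)) -
      ∑ n ∈ Finset.range (N k), b.coord n (∑' k, x k) • b (π n)‖ = 1 := by
    intro k
    rw [← Finset.sum_Ico_eq_sub _ (hN.monotone k.le_succ), ← hgc (N k) k]
    congr 1
    rw [Finset.sum_congr rfl (g := fun n => ∑ j, if n = f (N k) k j then
      c (N k) k j • b (π n) else 0), Finset.sum_comm]
    · refine Finset.sum_congr rfl fun j _ => ?_
      rw [Finset.sum_ite_eq', if_pos, hπ k j]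
      rw [Finset.mem_Ico]
      exact hfM _ _ j
    · intro n hn
      rw [Finset.mem_Ico] at hn
      rw [hcoord k n hn.1 hn.2, Finset.sum_smul]
      refine Finset.sum_congr rfl fun j _ => ?_
      split_ifs <;> simp
  have h3 := h1.norm
  simp only [norm_zero] at h3
  have h4 : Tendsto (fun _ : ℕ => (1 : ℝ)) atTop (𝓝 0) := h3.congr (fun k => h2 k)
  exact one_ne_zero (tendsto_nhds_unique tendsto_const_nhds h4)

end SchauderBasis

/-! ### Small averages from a convergent, not absolutely summable expansion. -/

/-- Addition in `Fin p` is cyclic, so over all shifts each coefficient meets each vector exactly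
once. Summing over shifts thus trades arbitrary coefficients for equal ones. -/
theorem sum_sum_smul_add {Z : Type*} [AddCommGroup Z] [Module ℝ Z] {p : ℕ} [NeZero p]
    (c : Fin p → ℝ) (z : Fin p → Z) :
    ∑ s, ∑ j, c j • z (j + s) = (∑ j, c j) • ∑ j, z j := by
  rw [Finset.sum_comm, Finset.sum_smul]
  refine Finset.sum_congr rfl fun j _ => ?_
  rw [← Finset.smul_sum]
  congr 1
  exact _root_.Equiv.sum_comp (Equiv.addLeft j) z

/-- Blocks of size `p` are removed one at a time; fewer than `p` vectors remain, and they contribute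
at most `p`. -/
theorem norm_sum_le_of_card_eq {Z : Type*} [NormedAddCommGroup Z] (z : ℕ → Z)
    (hz : ∀ n, ‖z n‖ ≤ 1) (q : ℕ → Prop) {p : ℕ} (hp : 0 < p) {ε : ℝ} (hε : 0 ≤ ε)
    (h : ∀ F : Finset ℕ, (∀ i ∈ F, q i) → F.card = p → ‖∑ i ∈ F, z i‖ ≤ ε * p) (m : ℕ) :
    ∀ F : Finset ℕ, (∀ i ∈ F, q i) → F.card = m → ‖∑ i ∈ F, z i‖ ≤ ε * m + p := by
  induction m using Nat.strong_induction_on with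
  | _ m ih =>
    intro F hF hm
    rcases lt_or_ge m p with hmp | hmp
    · have h1 : ‖∑ i ∈ F, z i‖ ≤ m := by
        refine (norm_sum_le_of_le F fun i _ => hz i).trans ?_
        simp [hm]
      have h2 : (m : ℝ) ≤ p := by exact_mod_cast hmp.le
      nlinarith [mul_nonneg hε (Nat.cast_nonneg (α := ℝ) m)]
    · obtain ⟨G, hGF, hG⟩ := Finset.exists_subset_card_eq (hm ▸ hmp)
      have hc : (F \ G).card = m - p := by rw [Finset.card_sdiff_of_subset hGF, hm, hG]
      have h1 := ih (m - p) (by omega) (F \ G)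
        (fun i hi => hF i (Finset.mem_sdiff.1 hi).1) hc
      have h2 := h G (fun i hi => hF i (hGF hi)) hG
      rw [← Finset.sum_sdiff hGF]
      refine (norm_add_le _ _).trans ?_
      rw [Nat.cast_sub hmp] at h1
      linarith

section SchauderBasis

variable {X : Type*} [NormedAddCommGroup X] [NormedSpace ℝ X] [CompleteSpace X]

/-- A symmetric basis is unconditional, in the following weak sense. -/
theorem SchauderBasis.exists_norm_sum_max_le (b : SchauderBasis ℝ X) {N : ℕ} {K : ℝ}
    (hK : ∀ (p : ℕ) (f g : Fin p → ℕ), Function.Injective f → Function.Injective g →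
      (∀ j, N ≤ f j) → (∀ j, N ≤ g j) → ∀ c : Fin p → ℝ,
      ‖∑ j, c j • b (g j)‖ ≤ K * ‖∑ j, c j • b (f j)‖)
    (hK0 : 0 ≤ K) {a : ℕ → ℝ} (ha : SeriesConverges (fun n => a n • b n)) :
    ∃ C : ℝ, 0 ≤ C ∧ ∀ p : ℕ, ‖∑ j : Fin p, max (a (N + j)) 0 • b (N + j)‖ ≤ C := by
  obtain ⟨B, hB⟩ := b.exists_norm_proj_le
  obtain ⟨s, hs⟩ := ha
  obtain ⟨C, hC⟩ := (Metric.isBounded_range_of_tendsto _ hs).exists_norm_le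
  have hC' : ∀ n, ‖∑ i ∈ Finset.range n, a i • b i‖ ≤ C := fun n => hC _ ⟨n, rfl⟩
  have hC0 : 0 ≤ C := (norm_nonneg _).trans (hC' 0)
  have hB0 : 0 ≤ B := (norm_nonneg _).trans (hB 0)
  refine ⟨B * (K * (C + C)), by positivity, fun p => ?_⟩
  -- Indices with positive coefficient stay in place and the others move beyond `N + p`, where the
  -- basis projection kills them. Symmetry thus does the work of unconditionality.
  let g : Fin p → ℕ := fun j => if 0 < a (N + j) then N + j else N + p + j
  have h1 := hK p (fun j => N + j) g (fun i j hij => by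
      simp only [add_right_inj] at hij; exact Fin.ext hij) (fun i j hij => by
      have := i.2
      have := j.2
      simp only [g] at hij
      apply Fin.ext
      split_ifs at hij <;> omega) (fun j => by omega) (fun j => by
      simp only [g]; split_ifs <;> omega) (fun j => a (N + j))
  have h2 : ‖∑ j : Fin p, a (N + j) • b (N + j)‖ ≤ C + C := by
    have h3 := Finset.sum_range_add (fun i => a i • b i) N p
    rw [Fin.sum_univ_eq_sum_range (fun j => a (N + j) • b (N + j)) p,
      ← sub_eq_of_eq_add' h3]
    exact (norm_sub_le _ _).trans (add_le_add (hC' _) (hC' _))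
  have h3 : ∑ j : Fin p, max (a (N + j)) 0 • b (N + j) =
      b.proj (N + p) (∑ j : Fin p, a (N + j) • b (g j)) := by
    rw [map_sum]
    refine Finset.sum_congr rfl fun j _ => ?_
    rw [map_smul, b.proj_apply_basis_mem]
    by_cases hj : 0 < a (N + j)
    · simp only [g, if_pos hj, max_eq_left hj.le]
      rw [if_pos (by omega)]
    · simp only [g, if_neg hj, max_eq_right (not_lt.1 hj)]
      rw [if_neg (by omega), smul_zero, zero_smul]
  rw [h3]
  refine ((b.proj (N + p)).le_opNorm _).trans ?_
  exact mul_le_mul (hB _) (h1.trans (mul_le_mul_of_nonneg_left h2 hK0)) (norm_nonneg _) hB0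

/-- The positive parts cⱼ of the coefficients have bounded block sums, and by symmetry so has every
cyclic shift placed on a set `F` of size `p`. Summing the `p` shifts gives (∑ cⱼ) ‖∑_{i ∈ F} b i‖ ≤
p K C, and ∑ cⱼ is unbounded in `p`. -/
theorem SchauderBasis.exists_small_averages_of_not_summable_max (b : SchauderBasis ℝ X)
    (hb : ∀ n, ‖b n‖ ≤ 1) {N : ℕ} {K : ℝ}
    (hK : ∀ (p : ℕ) (f g : Fin p → ℕ), Function.Injective f → Function.Injective g →
      (∀ j, N ≤ f j) → (∀ j, N ≤ g j) → ∀ c : Fin p → ℝ,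
      ‖∑ j, c j • b (g j)‖ ≤ K * ‖∑ j, c j • b (f j)‖)
    (hK0 : 0 ≤ K) {a : ℕ → ℝ} (ha : SeriesConverges (fun n => a n • b n))
    (hna : ¬ Summable (fun n => max (a n) 0)) {ε : ℝ} (hε : 0 < ε) :
    ∃ M : ℕ, ∀ F : Finset ℕ, (∀ i ∈ F, N ≤ i) → M ≤ F.card →
      ‖∑ i ∈ F, b i‖ ≤ ε * F.card := by
  obtain ⟨C, hC0, hC⟩ := b.exists_norm_sum_max_le hK hK0 ha
  rw [← summable_nat_add_iff N,
    not_summable_iff_tendsto_nat_atTop_of_nonneg (fun n => le_max_right _ _)] at hna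
  obtain ⟨p, hp, hp0⟩ := ((hna.eventually_ge_atTop (2 * (K * C) / ε + 1)).and
    (eventually_gt_atTop 0)).exists
  have : NeZero p := ⟨hp0.ne'⟩
  have hsum : ∑ j : Fin p, max (a (N + j)) 0 = ∑ i ∈ Finset.range p, max (a (i + N)) 0 := by
    rw [← Fin.sum_univ_eq_sum_range]
    simp only [add_comm N]
  have key : ∀ F : Finset ℕ, (∀ i ∈ F, N ≤ i) → F.card = p →
      ‖∑ i ∈ F, b i‖ ≤ ε / 2 * p := by
    intro F hF hFp
    let h := F.orderEmbOfFin hFp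
    have h1 : ∑ i ∈ F, b i = ∑ j, b (h j) := by
      conv_lhs => rw [← Finset.map_orderEmbOfFin_univ F hFp]
      rw [Finset.sum_map]
      rfl
    have h2 := sum_sum_smul_add (fun j : Fin p => max (a (N + j)) 0) (fun j => b (h j))
    have h3 : ∀ s : Fin p, ‖∑ j : Fin p, max (a (N + j)) 0 • b (h (j + s))‖ ≤ K * C := by
      intro s
      refine (hK p (fun j => N + j) (fun j => h (j + s)) (fun i j hij => by
        simp only [add_right_inj] at hij; exact Fin.ext hij) (fun i j hij => by
        simpa using hij) (fun j => by omega)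
        (fun j => hF _ (Finset.orderEmbOfFin_mem F hFp _)) _).trans ?_
      exact mul_le_mul_of_nonneg_left (hC p) hK0
    have h4 := norm_sum_le_of_le Finset.univ (fun s _ => h3 s)
    rw [h2, ← h1, norm_smul, hsum, Real.norm_of_nonneg (Finset.sum_nonneg fun i _ =>
      le_max_right _ _)] at h4
    simp only [Finset.sum_const, Finset.card_univ, Fintype.card_fin, nsmul_eq_mul] at h4
    have h5 : (2 * (K * C) / ε + 1) * ‖∑ i ∈ F, b i‖ ≤ p * (K * C) :=
      (mul_le_mul_of_nonneg_right hp (norm_nonneg _)).trans h4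
    have h6 : 0 < 2 * (K * C) / ε + 1 := by positivity
    have h7 : (p : ℝ) * (K * C) ≤ (2 * (K * C) / ε + 1) * (ε / 2 * p) := by
      have : (2 * (K * C) / ε + 1) * (ε / 2 * p) = p * (K * C) + ε / 2 * p := by
        field_simp
      rw [this]
      have : 0 ≤ ε / 2 * p := by positivity
      linarith
    exact le_of_mul_le_mul_left (h5.trans h7) h6
  -- From this size on the remainder `p` is at most ε/2 times the cardinality; the full blocks
  -- account for the other ε/2.
  refine ⟨⌈2 * p / ε⌉₊, fun F hF hFM => ?_⟩
  have h1 := norm_sum_le_of_card_eq b hb (fun i => N ≤ i) hp0 (by positivity) key F.card F hF rfl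
  have h2 : 2 * p / ε ≤ F.card := (Nat.le_ceil _).trans (by exact_mod_cast hFM)
  rw [div_le_iff₀ hε] at h2
  linarith

theorem SchauderBasis.exists_small_averages (b : SchauderBasis ℝ X)
    (hb : ∀ n, ‖b n‖ ≤ 1)
    (hsym : ∀ (σ : Equiv.Perm ℕ) (a : ℕ → ℝ), SeriesConverges (fun n => a n • b n) →
      SeriesConverges (fun n => a n • b (σ n)))
    {a : ℕ → ℝ} (ha : SeriesConverges (fun n => a n • b n))
    (hna : ¬ Summable (fun n => |a n|)) :
    ∃ N : ℕ, ∀ ε > 0, ∃ M : ℕ, ∀ F : Finset ℕ, (∀ i ∈ F, N ≤ i) → M ≤ F.card →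
      ‖∑ i ∈ F, b i‖ ≤ ε * F.card := by
  obtain ⟨N, K, hK⟩ := b.exists_symmetric_bound hsym
  have hK' : ∀ (p : ℕ) (f g : Fin p → ℕ), Function.Injective f → Function.Injective g →
      (∀ j, N ≤ f j) → (∀ j, N ≤ g j) → ∀ c : Fin p → ℝ,
      ‖∑ j, c j • b (g j)‖ ≤ |K| * ‖∑ j, c j • b (f j)‖ := fun p f g hf hg hf' hg' c =>
    (hK p f g hf hg hf' hg' c).trans (mul_le_mul_of_nonneg_right (le_abs_self K) (norm_nonneg _))
  refine ⟨N, fun ε hε => ?_⟩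
  by_cases h1 : Summable (fun n => max (a n) 0)
  · have h2 : ¬ Summable (fun n => max (-a n) 0) := fun h2 => hna <| by
      refine (h1.add h2).congr fun n => ?_
      rcases le_total 0 (a n) with h | h
      · simp [h, abs_of_nonneg h]
      · simp [h, abs_of_nonpos h]
    refine b.exists_small_averages_of_not_summable_max hb hK' (abs_nonneg K) ?_ h2 hε
    obtain ⟨s, hs⟩ := ha
    exact ⟨-s, by simpa using hs.neg⟩
  · exact b.exists_small_averages_of_not_summable_max hb hK' (abs_nonneg K) ha h1 hε

end SchauderBasis

/-! ### Comparison with ℓ₁. -/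

theorem seriesConverges_coe_iff {Y : Type*} [NormedAddCommGroup Y] [NormedSpace ℝ Y]
    [CompleteSpace Y] {S : Submodule ℝ Y} (hS : IsClosed (S : Set Y)) (x : ℕ → S) :
    SeriesConverges (fun n => (x n : Y)) ↔ SeriesConverges x := by
  constructor
  · rintro ⟨s, hs⟩
    have hmem : s ∈ S := hS.mem_of_tendsto hs
      (Eventually.of_forall fun N => S.sum_mem fun i _ => (x i).2)
    refine ⟨⟨s, hmem⟩, ?_⟩
    rw [tendsto_subtype_rng]
    simpa using hs
  · rintro ⟨s, hs⟩
    refine ⟨s, ?_⟩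
    have := (continuous_subtype_val.tendsto s).comp hs
    simpa [Function.comp_def] using this

theorem seriesConverges_l1UnitVector_iff (a : ℕ → ℝ) :
    SeriesConverges (fun n => a n • l1UnitVector n) ↔ Summable (fun n => |a n|) := by
  constructor
  · rintro ⟨s, hs⟩
    obtain ⟨C, hC⟩ := (Metric.isBounded_range_of_tendsto _ hs).exists_norm_le
    refine summable_of_sum_range_le (c := C) (fun n => abs_nonneg _) fun n => ?_
    have h1 := hC _ ⟨n, rfl⟩
    refine le_trans ?_ h1
    have h2 := lp.norm_sum_single (p := 1) (by simp) a (Finset.range n)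
    simp only [ENNReal.toReal_one, Real.rpow_one, Real.norm_eq_abs] at h2
    rw [← h2]
    apply le_of_eq
    congr 1
    refine Finset.sum_congr rfl fun i _ => ?_
    simp [l1UnitVector, ← lp.single_smul]
  · intro h
    have : Summable (fun n => a n • l1UnitVector n) := by
      refine Summable.of_norm (h.congr fun n => ?_)
      rw [norm_smul, l1UnitVector, lp.norm_single (by simp)]
      simp
    exact ⟨_, this.hasSum.tendsto_sum_nat⟩

/-- A symmetric basic sequence which is not equivalent to the unit vector basis of `ℓ₁` has a
tail on which the averages of long blocks are small. -/
theorem exists_seq_small_averages {Y : Type*} [NormedAddCommGroup Y] [NormedSpace ℝ Y]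
    [CompleteSpace Y] (y : ℕ → Y) (hy : ∀ n, ‖y n‖ = 1) (hs : IsSymmetricBasicSequence y)
    (hl : ¬ EquivSeq y l1UnitVector) :
    ∃ z : ℕ → Y, (∀ n, ‖z n‖ = 1) ∧ ∀ ε > 0, ∃ M : ℕ, ∀ F : Finset ℕ, M ≤ F.card →
      ‖∑ i ∈ F, z i‖ ≤ ε * F.card := by
  have hcl : IsClosed (closedSpan y : Set Y) := Submodule.isClosed_topologicalClosure _
  have : CompleteSpace (closedSpan y) := hcl.completeSpace_coe
  obtain ⟨⟨b, hb⟩, hσ⟩ := hs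
  have hby : ∀ n, (b n : Y) = y n := fun n => by rw [hb]; rfl
  have hconv : ∀ a : ℕ → ℝ, SeriesConverges (fun n => a n • b n) ↔
      SeriesConverges (fun n => a n • y n) := fun a => by
    rw [← seriesConverges_coe_iff hcl]
    simp [hby]
  -- For normalized vectors absolute summability always gives convergence, so only the converse
  -- implication can fail.
  obtain ⟨a, ha, hna⟩ : ∃ a : ℕ → ℝ, SeriesConverges (fun n => a n • y n) ∧
      ¬ Summable (fun n => |a n|) := by
    by_contra! H
    refine hl fun a => ?_
    rw [seriesConverges_l1UnitVector_iff]
    refine ⟨H a, fun h => ?_⟩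
    have : Summable (fun n => a n • y n) :=
      Summable.of_norm (h.congr fun n => by simp [norm_smul, hy])
    exact ⟨_, this.hasSum.tendsto_sum_nat⟩
  have hsym : ∀ (σ : Equiv.Perm ℕ) (a : ℕ → ℝ), SeriesConverges (fun n => a n • b n) →
      SeriesConverges (fun n => a n • b (σ n)) := by
    intro σ a h
    simp only [hb] at h ⊢
    exact ((hσ σ).2 a).2 h
  have hb1 : ∀ n, ‖b n‖ ≤ 1 := fun n => by
    rw [← hy n, ← hby n, Submodule.coe_norm]
  obtain ⟨N, hN⟩ := b.exists_small_averages hb1 hsym ((hconv a).2 ha) hna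
  refine ⟨fun n => y (n + N), fun n => hy _, fun ε hε => ?_⟩
  obtain ⟨M, hM⟩ := hN ε hε
  refine ⟨M, fun F hF => ?_⟩
  have h1 := hM (F.map (addRightEmbedding N)) (by simp) (by simpa using hF)
  rw [Finset.card_map, Finset.sum_map] at h1
  have h2 : ((∑ i ∈ F, b (addRightEmbedding N i) : closedSpan y) : Y) = ∑ i ∈ F, y (i + N) := by
    simp [hby]
  rw [← h2]
  exact h1

/-! ### A rate for the averages, and summation by parts. -/

/-- The rate is the square root of the tail supremum of the averages, plus 1/(m+1) to make it
positive and strictly decreasing. The square leaves one factor r for the norm of the flat space and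
one that telescopes in the summation by parts. -/
theorem exists_rate {Y : Type*} [NormedAddCommGroup Y] (z : ℕ → Y) (hz : ∀ n, ‖z n‖ ≤ 1)
    (h : ∀ ε > 0, ∃ M : ℕ, ∀ F : Finset ℕ, M ≤ F.card → ‖∑ i ∈ F, z i‖ ≤ ε * F.card) :
    ∃ r : ℕ → ℝ, StrictAnti r ∧ (∀ m, 0 < r m) ∧ Tendsto r atTop (𝓝 0) ∧
      ∀ F : Finset ℕ, ‖∑ i ∈ F, z i‖ ≤ F.card * r F.card ^ 2 := by
  let S : ℕ → Type := fun m => {F : Finset ℕ // m ≤ F.card}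
  have hne : ∀ m, Nonempty (S m) := fun m => ⟨⟨Finset.range m, by simp⟩⟩
  let φ : Finset ℕ → ℝ := fun F => ‖∑ i ∈ F, z i‖ / F.card
  have hφ0 : ∀ F, 0 ≤ φ F := fun F => by positivity
  have hφ1 : ∀ F, φ F ≤ 1 := fun F => by
    refine div_le_one_of_le₀ ?_ (Nat.cast_nonneg _)
    refine (norm_sum_le_of_le F fun i _ => hz i).trans ?_
    simp
  let ε : ℕ → ℝ := fun m => ⨆ F : S m, φ F.1
  have hbdd : ∀ m, BddAbove (Set.range fun F : S m => φ F.1) := fun m =>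
    ⟨1, by rintro _ ⟨F, rfl⟩; exact hφ1 _⟩
  have hφε : ∀ m (F : Finset ℕ), m ≤ F.card → φ F ≤ ε m := fun m F hF =>
    le_ciSup (hbdd m) (⟨F, hF⟩ : S m)
  have hε0 : ∀ m, 0 ≤ ε m := fun m => Real.iSup_nonneg fun F => hφ0 _
  have hεanti : Antitone ε := fun m n hmn => by
    have := hne n
    exact ciSup_le fun F => hφε m F.1 (hmn.trans F.2)
  have hεlim : Tendsto ε atTop (𝓝 0) := by
    rw [Metric.tendsto_atTop]
    intro η hη
    obtain ⟨M, hM⟩ := h (η / 2) (by positivity)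
    refine ⟨M, fun n hn => ?_⟩
    rw [Real.dist_0_eq_abs, abs_of_nonneg (hε0 n)]
    have := hne n
    refine lt_of_le_of_lt (ciSup_le fun F => ?_) (half_lt_self hη)
    exact div_le_of_le_mul₀ (Nat.cast_nonneg _) (by positivity) (hM F.1 (hn.trans F.2))
  refine ⟨fun m => √(ε m) + 1 / ((m : ℝ) + 1), fun m n hmn => ?_, fun m => by positivity, ?_,
    fun F => ?_⟩
  · have h1 : √(ε n) ≤ √(ε m) := Real.sqrt_le_sqrt (hεanti hmn.le)
    have h2 : (1 : ℝ) / ((n : ℝ) + 1) < 1 / ((m : ℝ) + 1) := Nat.one_div_lt_one_div hmn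
    exact add_lt_add_of_le_of_lt h1 h2
  · simpa using hεlim.sqrt.add tendsto_one_div_add_atTop_nhds_zero_nat
  · rcases F.eq_empty_or_nonempty with rfl | hF
    · simp
    · have hc : (0 : ℝ) < F.card := by exact_mod_cast hF.card_pos
      have h1 : ‖∑ i ∈ F, z i‖ ≤ F.card * ε F.card := by
        have := hφε F.card F le_rfl
        simp only [φ] at this
        rwa [div_le_iff₀' hc] at this
      refine h1.trans (mul_le_mul_of_nonneg_left ?_ hc.le)
      have h2 : (0 : ℝ) ≤ 1 / ((F.card : ℝ) + 1) := by positivity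
      calc ε F.card = √(ε F.card) ^ 2 := (Real.sq_sqrt (hε0 _)).symm
        _ ≤ _ := pow_le_pow_left₀ (Real.sqrt_nonneg _) (by linarith) 2

/-- A majorization estimate, by summation by parts along the decreasing rearrangement. -/
theorem norm_sum_sub_smul_le {Y : Type*} [NormedAddCommGroup Y] [NormedSpace ℝ Y] {z : ℕ → Y}
    {r : ℕ → ℝ} (hr : Antitone r) (hr0 : ∀ m, 0 < r m)
    (hz : ∀ F : Finset ℕ, ‖∑ i ∈ F, z i‖ ≤ F.card * r F.card ^ 2) {x : ℕ → ℝ} {M : ℝ}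
    (s : Finset ℕ) (hs : ∀ A ⊆ s, (∑ i ∈ A, x i) * r A.card ≤ M) :
    ∀ c : ℝ, 0 ≤ c → (∀ i ∈ s, c ≤ x i) → ‖∑ i ∈ s, (x i - c) • z i‖ ≤
      (∑ i ∈ s, (x i - c)) * r s.card ^ 2 + M * (2 * r 0 - 2 * r s.card) := by
  induction s using Finset.induction_on_min_value x with
  | empty => intro c _ _; simp
  | insert a s has hmin ih =>
    intro c hc hcx
    have ih' := ih (fun A hA => hs A (hA.trans (Finset.subset_insert _ _))) (x a)
      (hc.trans (hcx a (Finset.mem_insert_self _ _))) hmin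
    have hxa : 0 ≤ x a - c := sub_nonneg.2 (hcx a (Finset.mem_insert_self _ _))
    have hcard := Finset.card_insert_of_notMem has
    -- The new index carries the smallest value, so cutting at level `x a` splits off a constant
    -- layer over the whole set.
    have h1 : ∑ i ∈ insert a s, (x i - c) • z i =
        ∑ i ∈ s, (x i - x a) • z i + (x a - c) • ∑ i ∈ insert a s, z i := by
      rw [Finset.sum_insert has, Finset.sum_insert has, smul_add, Finset.smul_sum, add_left_comm,
        ← Finset.sum_add_distrib]
      simp only [← add_smul, sub_add_sub_cancel]
    have h2 : ∑ i ∈ insert a s, (x i - c) =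
        ∑ i ∈ s, (x i - x a) + (x a - c) * (s.card + 1) := by
      rw [Finset.sum_insert has]
      simp only [Finset.sum_sub_distrib, Finset.sum_const, nsmul_eq_mul]
      ring
    have h3 : (∑ i ∈ s, (x i - x a)) * r s.card ≤ M := by
      refine le_trans (mul_le_mul_of_nonneg_right (Finset.sum_le_sum fun i hi => ?_)
        (hr0 _).le) (hs s (Finset.subset_insert _ _))
      have := hc.trans (hcx a (Finset.mem_insert_self _ _))
      linarith
    have h4 : ‖(x a - c) • ∑ i ∈ insert a s, z i‖ ≤
        (x a - c) * ((s.card + 1) * r (s.card + 1) ^ 2) := by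
      rw [norm_smul, Real.norm_of_nonneg hxa]
      have := hz (insert a s)
      rw [hcard] at this
      push_cast at this
      exact mul_le_mul_of_nonneg_left this hxa
    have h5 : 0 ≤ ∑ i ∈ s, (x i - x a) :=
      Finset.sum_nonneg fun i hi => sub_nonneg.2 (hmin i hi)
    have h6 : r (s.card + 1) ≤ r s.card := hr (Nat.le_succ _)
    rw [h1, h2, hcard]
    refine (norm_add_le _ _).trans ((add_le_add ih' h4).trans ?_)
    have h7 := hr0 (s.card + 1)
    generalize (∑ i ∈ s, (x i - x a)) = U at *
    generalize r (s.card + 1) = q at *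
    generalize r s.card = t at *
    -- The price of replacing r(|s|)² by r(|s|+1)²: factor the difference of squares and use U (t +
    -- q) ≤ 2 U t ≤ 2 M. These costs telescope.
    have h8 : U * (t ^ 2 - q ^ 2) ≤ M * (2 * t - 2 * q) := by
      have h9 : U * (t + q) ≤ 2 * M := by nlinarith
      nlinarith [mul_le_mul_of_nonneg_right h9 (sub_nonneg.2 h6)]
    nlinarith

/-! ### The flat space and the operator on it. -/

section FlatSpace

/-- The vectors of `ℓ∞`, indexed by the finite sets `A`, whose closed span is the space normed by
`‖x‖ = sup_A r(|A|) |∑_{i ∈ A} xᵢ|`. -/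
noncomputable def flatVec {r : ℕ → ℝ} (hr : Antitone r) (hr0 : ∀ m, 0 < r m) (n : ℕ) :
    lp (fun _ : ULift.{v} (Finset ℕ) => ℝ) ⊤ :=
  ⟨fun A => if n ∈ A.down then r A.down.card else 0, memℓp_infty ⟨r 0, by
    rintro _ ⟨A, rfl⟩
    dsimp only
    split_ifs
    · rw [Real.norm_of_nonneg (hr0 _).le]
      exact hr (Nat.zero_le _)
    · simpa using (hr0 0).le⟩⟩

variable {r : ℕ → ℝ} (hr : Antitone r) (hr0 : ∀ m, 0 < r m)

theorem flatVec_apply (n : ℕ) (A : ULift.{v} (Finset ℕ)) :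
    flatVec hr hr0 n A = if n ∈ A.down then r A.down.card else 0 := rfl

theorem sum_smul_flatVec_apply (s : Finset ℕ) (a : ℕ → ℝ) (A : ULift.{v} (Finset ℕ)) :
    (∑ i ∈ s, a i • flatVec hr hr0 i : lp (fun _ : ULift.{v} (Finset ℕ) => ℝ) ⊤) A =
      (∑ i ∈ s ∩ A.down, a i) * r A.down.card := by
  rw [lp.coeFn_sum, Finset.sum_apply]
  simp only [lp.coeFn_smul, Pi.smul_apply, flatVec_apply, smul_eq_mul, mul_ite, mul_zero]
  rw [← Finset.sum_filter, Finset.filter_mem_eq_inter, Finset.sum_mul]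

theorem norm_flatVec_le (n : ℕ) : ‖flatVec.{v} hr hr0 n‖ ≤ r 0 := by
  refine lp.norm_le_of_forall_le (hr0 0).le fun A => ?_
  rw [flatVec_apply]
  split_ifs
  · rw [Real.norm_of_nonneg (hr0 _).le]
    exact hr (Nat.zero_le _)
  · simpa using (hr0 0).le

/-- Evaluations are contractions on ℓ∞, so the limit passes from the span to its closure. -/
theorem tendsto_apply_of_mem_closedSpan {ι β : Type*} {e : ℕ → lp (fun _ : ι => ℝ) ⊤}
    {l : Filter β} {φ : β → ι} (h : ∀ n, Tendsto (fun b => e n (φ b)) l (𝓝 0))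
    {x : lp (fun _ : ι => ℝ) ⊤} (hx : x ∈ closedSpan e) :
    Tendsto (fun b => x (φ b)) l (𝓝 0) := by
  have hspan : ∀ w ∈ Submodule.span ℝ (Set.range e), Tendsto (fun b => w (φ b)) l (𝓝 0) := by
    intro w hw
    induction hw using Submodule.span_induction with
    | mem w hw => obtain ⟨n, rfl⟩ := hw; exact h n
    | zero => simpa using tendsto_const_nhds
    | add w w' _ _ h1 h2 => simpa using h1.add h2
    | smul a w _ h1 => simpa using h1.const_mul a
  rw [Metric.tendsto_nhds]
  intro ε hε
  obtain ⟨w, hw, hxw⟩ := Metric.mem_closure_iff.1 hx (ε / 2) (by positivity)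
  filter_upwards [Metric.tendsto_nhds.1 (hspan w hw) (ε / 2) (by positivity)] with b hb
  rw [dist_zero_right] at hb ⊢
  have h1 := lp.norm_apply_le_norm ENNReal.top_ne_zero (x - w) (φ b)
  rw [lp.coeFn_sub, Pi.sub_apply, ← dist_eq_norm] at h1
  calc ‖x (φ b)‖ = ‖(x (φ b) - w (φ b)) + w (φ b)‖ := by rw [sub_add_cancel]
    _ ≤ ‖x (φ b) - w (φ b)‖ + ‖w (φ b)‖ := norm_add_le _ _
    _ < ε := by rw [← dist_eq_norm] at *; linarith

/-- Divided by r(|A|), the entry at A is the sum of the coordinates over A; this is its additivity,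
a closed linear condition checked on the generators. -/
theorem apply_insert_of_mem_closedSpan_flatVec {x : lp (fun _ : ULift.{v} (Finset ℕ) => ℝ) ⊤}
    (hx : x ∈ closedSpan (flatVec hr hr0)) {n : ℕ} {B : Finset ℕ} (hn : n ∉ B) :
    x ⟨insert n B⟩ * (r (B.card + 1))⁻¹ = x ⟨B⟩ * (r B.card)⁻¹ + x ⟨{n}⟩ * (r 1)⁻¹ := by
  have hcont : ∀ A, Continuous fun w : lp (fun _ : ULift.{v} (Finset ℕ) => ℝ) ⊤ => w A :=
    fun A => (lp.lipschitzWith_one_eval ⊤ A).continuous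
  have hcl : IsClosed {w : lp (fun _ : ULift.{v} (Finset ℕ) => ℝ) ⊤ |
      w ⟨insert n B⟩ * (r (B.card + 1))⁻¹ = w ⟨B⟩ * (r B.card)⁻¹ + w ⟨{n}⟩ * (r 1)⁻¹} :=
    isClosed_eq ((hcont _).mul_const _) (((hcont _).mul_const _).add ((hcont _).mul_const _))
  refine closure_minimal (fun w hw => ?_) hcl hx
  induction hw using Submodule.span_induction with
  | mem w hw =>
    obtain ⟨k, rfl⟩ := hw
    have h1 := (hr0 1).ne'
    have h2 := (hr0 B.card).ne'
    have h3 := (hr0 (B.card + 1)).ne'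
    simp only [Set.mem_ofPred_eq, flatVec_apply, Finset.mem_insert, Finset.mem_singleton,
      Finset.card_insert_of_notMem hn, Finset.card_singleton]
    by_cases hk : k = n
    · subst hk
      simp [hn, h1, h3]
    · by_cases hkB : k ∈ B <;> simp [hk, hkB, h2, h3]
  | zero => simp
  | add w w' _ _ h1 h2 =>
    simp only [Set.mem_ofPred_eq, lp.coeFn_add, Pi.add_apply] at *
    linear_combination h1 + h2
  | smul a w _ h1 =>
    simp only [Set.mem_ofPred_eq, lp.coeFn_smul, Pi.smul_apply, smul_eq_mul] at *
    linear_combination a * h1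

theorem exists_pos_le_of_forall_lt (f : ℕ → ℝ) (hf : ∀ m, 0 < f m) (k : ℕ) :
    ∃ c, 0 < c ∧ ∀ m < k, c ≤ f m := by
  induction k with
  | zero => exact ⟨1, one_pos, by simp⟩
  | succ k ih =>
    obtain ⟨c, hc, h⟩ := ih
    refine ⟨min c (f k), lt_min hc (hf k), fun m hm => ?_⟩
    rcases Nat.lt_succ_iff_lt_or_eq.1 hm with h1 | rfl
    · exact (min_le_left _ _).trans (h m h1)
    · exact min_le_right _ _

/-- Every point of the unit ball is the midpoint of small segments in the directions of all but
finitely many of the basis vectors. -/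
theorem exists_norm_add_smul_flatVec_le_one (hr' : StrictAnti r) (hlim : Tendsto r atTop (𝓝 0))
    {x : lp (fun _ : ULift.{v} (Finset ℕ) => ℝ) ⊤} (hx : x ∈ closedSpan (flatVec hr hr0))
    (hx1 : ‖x‖ ≤ 1) :
    ∃ δ > 0, ∃ N : ℕ, ∀ n ≥ N, ∀ s : ℝ, |s| ≤ δ → ‖x + s • flatVec hr hr0 n‖ ≤ 1 := by
  have hx1' : ∀ A, |x A| ≤ 1 := fun A =>
    (lp.norm_apply_le_norm ENNReal.top_ne_zero x A).trans hx1
  have hW : ∀ m, 0 < (r (m + 1))⁻¹ - (r m)⁻¹ := fun m =>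
    sub_pos.2 ((inv_lt_inv₀ (hr0 _) (hr0 _)).2 (hr' (Nat.lt_succ_self m)))
  have hcard : Tendsto (fun A : Finset ℕ => x ⟨A⟩) (comap Finset.card atTop) (𝓝 0) := by
    refine tendsto_apply_of_mem_closedSpan (fun n => ?_) hx
    refine squeeze_zero (fun A => ?_) (fun A => ?_) (hlim.comp tendsto_comap)
    · rw [flatVec_apply]; split_ifs; exacts [(hr0 _).le, le_rfl]
    · rw [flatVec_apply]; split_ifs; exacts [le_rfl, (hr0 _).le]
  have hsing : Tendsto (fun n : ℕ => x ⟨{n}⟩) atTop (𝓝 0) := by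
    refine tendsto_apply_of_mem_closedSpan (φ := fun n : ℕ => ⟨{n}⟩) (fun n => ?_) hx
    refine tendsto_const_nhds.congr' ?_
    filter_upwards [eventually_gt_atTop n] with m hm
    rw [flatVec_apply, if_neg]
    simpa using hm.ne
  obtain ⟨k, hk⟩ : ∃ k : ℕ, ∀ A : Finset ℕ, k ≤ A.card → |x ⟨A⟩| ≤ 1 / 2 := by
    have h1 := Metric.tendsto_nhds.1 hcard (1 / 2) (by norm_num)
    rw [eventually_comap] at h1
    obtain ⟨k, hk⟩ := eventually_atTop.1 h1
    refine ⟨k, fun A hA => ?_⟩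
    have := hk _ hA A rfl
    rw [Real.dist_0_eq_abs] at this
    exact this.le
  -- For |B| < k there is room because 1/r increases strictly, by at least `c` in finitely many
  -- steps. For |B| ≥ k the entry is at most 1/2, which leaves at least 1/(2 r 0). The new index
  -- needs room 2δ: δ for the coordinate of `x` at `n`, δ for `s`.
  obtain ⟨c, hc, hck⟩ := exists_pos_le_of_forall_lt _ hW k
  have hr00 := inv_pos.2 (hr0 0)
  set δ := min c ((r 0)⁻¹ / 2) / 2 with hδ
  have hδ0 : 0 < δ := by positivity
  have hδc : 2 * δ ≤ c := by
    have := min_le_left c ((r 0)⁻¹ / 2)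
    linarith
  have hδr : 2 * δ ≤ (r 0)⁻¹ / 2 := by
    have := min_le_right c ((r 0)⁻¹ / 2)
    linarith
  have h1 := hsing.mul_const (r 1)⁻¹
  rw [zero_mul] at h1
  obtain ⟨N, hN⟩ := Metric.tendsto_atTop.1 h1 δ hδ0
  refine ⟨δ, hδ0, N, fun n hn s hs => ?_⟩
  refine lp.norm_le_of_forall_le zero_le_one fun ⟨A⟩ => ?_
  rw [lp.coeFn_add, Pi.add_apply, lp.coeFn_smul, Pi.smul_apply, flatVec_apply, Real.norm_eq_abs]
  by_cases hnA : n ∈ A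
  · obtain ⟨B, hnB, rfl⟩ : ∃ B, n ∉ B ∧ insert n B = A :=
      ⟨A.erase n, Finset.notMem_erase _ _, Finset.insert_erase hnA⟩
    have h2 := apply_insert_of_mem_closedSpan_flatVec hr hr0 hx hnB
    have hw : 0 < (r (B.card + 1))⁻¹ := inv_pos.2 (hr0 _)
    rw [if_pos hnA, Finset.card_insert_of_notMem hnB, smul_eq_mul]
    have h3 : (x ⟨insert n B⟩ + s * r (B.card + 1)) * (r (B.card + 1))⁻¹ =
        x ⟨B⟩ * (r B.card)⁻¹ + x ⟨{n}⟩ * (r 1)⁻¹ + s := by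
      rw [add_mul, h2, mul_inv_cancel_right₀ (hr0 _).ne']
    have h4 := hN n hn
    rw [Real.dist_0_eq_abs] at h4
    have hwB : 0 < (r B.card)⁻¹ := inv_pos.2 (hr0 _)
    have h5 : |x ⟨B⟩ * (r B.card)⁻¹| + 2 * δ ≤ (r (B.card + 1))⁻¹ := by
      rw [abs_mul, abs_of_pos hwB]
      rcases lt_or_ge B.card k with hBk | hBk
      · have := hck _ hBk
        have := mul_le_mul_of_nonneg_right (hx1' ⟨B⟩) hwB.le
        linarith
      · have h6 := mul_le_mul_of_nonneg_right (hk B hBk) hwB.le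
        have h7 : (r 0)⁻¹ ≤ (r B.card)⁻¹ :=
          (inv_le_inv₀ (hr0 _) (hr0 _)).2 (hr (Nat.zero_le _))
        have := hW B.card
        linarith
    have h8 : |(x ⟨insert n B⟩ + s * r (B.card + 1)) * (r (B.card + 1))⁻¹| ≤
        1 * (r (B.card + 1))⁻¹ := by
      rw [h3, one_mul]
      refine (abs_add_le _ _).trans ?_
      have := abs_add_le (x ⟨B⟩ * (r B.card)⁻¹) (x ⟨{n}⟩ * (r 1)⁻¹)
      linarith
    rw [abs_mul, abs_of_pos hw] at h8
    exact le_of_mul_le_mul_right h8 hw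
  · rw [if_neg hnA, smul_zero, add_zero]
    exact hx1' _

/-- The entry at A is r(|A|) |F ∩ A|: for large A the factor r(|A|) is below η, and for small A the
entry is bounded independently of F. -/
theorem exists_norm_sum_flatVec_le (hlim : Tendsto r atTop (𝓝 0)) {η : ℝ} (hη : 0 < η) :
    ∃ M : ℕ, ∀ F : Finset ℕ, M ≤ F.card → ‖∑ n ∈ F, flatVec.{v} hr hr0 n‖ ≤ η * F.card := by
  obtain ⟨k, hk⟩ := (hlim.eventually_lt_const hη).exists
  refine ⟨⌈k * r 0 / η⌉₊, fun F hF => ?_⟩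
  refine lp.norm_le_of_forall_le (by positivity) fun ⟨A⟩ => ?_
  have h1 := sum_smul_flatVec_apply hr hr0 F (fun _ => 1) ⟨A⟩
  simp only [one_smul, Finset.sum_const, nsmul_eq_mul, mul_one] at h1
  rw [h1, Real.norm_of_nonneg (mul_nonneg (Nat.cast_nonneg _) (hr0 _).le)]
  rcases le_total k A.card with h | h
  · rw [mul_comm]
    have h2 : ((F ∩ A).card : ℝ) ≤ F.card := by
      exact_mod_cast Finset.card_le_card Finset.inter_subset_left
    exact mul_le_mul ((hr h).trans hk.le) h2 (Nat.cast_nonneg _) hη.le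
  · have h2 : ((F ∩ A).card : ℝ) ≤ k := by
      exact_mod_cast (Finset.card_le_card Finset.inter_subset_right).trans h
    have h3 : k * r 0 / η ≤ F.card := (Nat.le_ceil _).trans (by exact_mod_cast hF)
    rw [div_le_iff₀ hη, mul_comm (F.card : ℝ)] at h3
    exact (mul_le_mul h2 (hr (Nat.zero_le _)) (hr0 _).le (Nat.cast_nonneg _)).trans h3

theorem norm_sum_smul_le_of_rate {Y : Type*} [NormedAddCommGroup Y] [NormedSpace ℝ Y] {z : ℕ → Y}
    (hz : ∀ F : Finset ℕ, ‖∑ i ∈ F, z i‖ ≤ F.card * r F.card ^ 2) (s : Finset ℕ) (a : ℕ → ℝ) :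
    ‖∑ i ∈ s, a i • z i‖ ≤ 6 * r 0 * ‖∑ i ∈ s, a i • flatVec.{v} hr hr0 i‖ := by
  set M := ‖∑ i ∈ s, a i • flatVec.{v} hr hr0 i‖
  have hM0 : 0 ≤ M := norm_nonneg _
  have hA : ∀ A ⊆ s, |∑ i ∈ A, a i| * r A.card ≤ M := by
    intro A hAs
    have h1 := lp.norm_apply_le_norm ENNReal.top_ne_zero
      (∑ i ∈ s, a i • flatVec.{v} hr hr0 i) ⟨A⟩
    rw [sum_smul_flatVec_apply, Finset.inter_eq_right.2 hAs, norm_mul,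
      Real.norm_of_nonneg (hr0 _).le] at h1
    exact h1
  have key : ∀ (x : ℕ → ℝ) (t : Finset ℕ), t ⊆ s → (∀ A, |∑ i ∈ A, x i| = |∑ i ∈ A, a i|) →
      (∀ i ∈ t, 0 ≤ x i) → ‖∑ i ∈ t, x i • z i‖ ≤ 3 * r 0 * M := by
    intro x t hts hx hx0
    have hA' : ∀ A ⊆ t, (∑ i ∈ A, x i) * r A.card ≤ M := fun A hAt =>
      (mul_le_mul_of_nonneg_right ((le_abs_self _).trans (hx A).le) (hr0 _).le).trans
        (hA A (hAt.trans hts))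
    have h1 := norm_sum_sub_smul_le hr hr0 hz t hA' 0 le_rfl hx0
    simp only [sub_zero] at h1
    have h2 := mul_le_mul_of_nonneg_right (hA' t subset_rfl) (hr0 t.card).le
    have h3 := mul_le_mul_of_nonneg_left (hr (Nat.zero_le t.card)) hM0
    have h4 := mul_nonneg hM0 (hr0 t.card).le
    nlinarith
  -- Nonnegative and negative coefficients are treated separately, each part costing at most 3 r 0
  -- times the norm.
  have h1 := key a (s.filter (0 ≤ a ·)) (Finset.filter_subset _ _) (fun _ => rfl)
    (fun i hi => (Finset.mem_filter.1 hi).2)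
  have h2 := key (fun i => -a i) (s.filter (¬ 0 ≤ a ·)) (Finset.filter_subset _ _)
    (fun A => by rw [Finset.sum_neg_distrib, abs_neg])
    (fun i hi => by have := (Finset.mem_filter.1 hi).2; linarith)
  simp only [neg_smul, Finset.sum_neg_distrib, norm_neg] at h2
  rw [← Finset.sum_filter_add_sum_filter_not s (0 ≤ a ·)]
  refine (norm_add_le _ _).trans ?_
  linarith

theorem denseRange_linearCombination_toClosedSpan {Y : Type*} [NormedAddCommGroup Y]
    [NormedSpace ℝ Y] (y : ℕ → Y) :
    DenseRange (Finsupp.linearCombination ℝ (toClosedSpan y)) := by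
  rintro ⟨x, hx⟩
  rw [closure_subtype]
  refine closure_mono ?_ (show x ∈ closure _ from hx)
  intro w hw
  obtain ⟨c, rfl⟩ := (Finsupp.mem_span_range_iff_exists_finsupp).1 hw
  refine ⟨_, ⟨c, rfl⟩, ?_⟩
  simp [Finsupp.linearCombination_apply, Finsupp.sum, toClosedSpan]

theorem exists_operator_flatVec {Y : Type*} [NormedAddCommGroup Y] [NormedSpace ℝ Y]
    [CompleteSpace Y] {z : ℕ → Y}
    (hz : ∀ F : Finset ℕ, ‖∑ i ∈ F, z i‖ ≤ F.card * r F.card ^ 2) :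
    ∃ T : closedSpan (flatVec.{v} hr hr0) →L[ℝ] Y,
      ∀ n, T (toClosedSpan (flatVec.{v} hr hr0) n) = z n := by
  have hd := denseRange_linearCombination_toClosedSpan (flatVec.{v} hr hr0)
  have hb : ∀ a : ℕ →₀ ℝ, ‖Finsupp.linearCombination ℝ z a‖ ≤ 6 * r 0 *
      ‖Finsupp.linearCombination ℝ (toClosedSpan (flatVec.{v} hr hr0)) a‖ := by
    intro a
    have h := norm_sum_smul_le_of_rate.{v} hr hr0 hz a.support a
    have h2 : ((Finsupp.linearCombination ℝ (toClosedSpan (flatVec.{v} hr hr0)) a :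
        closedSpan (flatVec.{v} hr hr0)) : lp (fun _ : ULift.{v} (Finset ℕ) => ℝ) ⊤) =
        ∑ i ∈ a.support, a i • flatVec.{v} hr hr0 i := by
      simp [Finsupp.linearCombination_apply, Finsupp.sum, toClosedSpan]
    rw [← h2] at h
    exact h
  refine ⟨(Finsupp.linearCombination ℝ z).extendOfNorm
    (Finsupp.linearCombination ℝ (toClosedSpan (flatVec.{v} hr hr0))), fun n => ?_⟩
  have := LinearMap.extendOfNorm_eq hd ⟨_, hb⟩ (Finsupp.single n 1)
  simpa using this

end FlatSpace

/-! ### Norm-attaining operators into locally AMUC spaces. -/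

/-- Otherwise compactness yields a subsequence of images converging to some q with ‖q‖ ≥ ε. Its long
averages lie within ε/2 of q, yet have norm at most ε/4. -/
theorem tendsto_map_zero_of_small_averages {X Q : Type*} [NormedAddCommGroup X] [NormedSpace ℝ X]
    [NormedAddCommGroup Q] [NormedSpace ℝ Q] [FiniteDimensional ℝ Q] (R : X →L[ℝ] Q)
    {e : ℕ → X} {C : ℝ} (hC : ∀ n, ‖e n‖ ≤ C)
    (he : ∀ η > 0, ∃ M : ℕ, ∀ F : Finset ℕ, M ≤ F.card → ‖∑ n ∈ F, e n‖ ≤ η * F.card) :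
    Tendsto (fun n => R (e n)) atTop (𝓝 0) := by
  rw [Metric.tendsto_atTop]
  by_contra! H
  obtain ⟨ε, hε, H⟩ := H
  obtain ⟨φ, hφ, hφε⟩ := extraction_of_frequently_atTop (frequently_atTop.2 H)
  have : ProperSpace Q := FiniteDimensional.proper ℝ Q
  obtain ⟨q, -, ψ, hψ, hq⟩ := tendsto_subseq_of_bounded (x := fun n => R (e (φ n)))
    (s := Metric.closedBall 0 (‖R‖ * C)) Metric.isBounded_closedBall (fun n => by
      rw [mem_closedBall_zero_iff]
      exact (R.le_opNorm _).trans (mul_le_mul_of_nonneg_left (hC _) (norm_nonneg _)))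
  have hqε : ε ≤ ‖q‖ := ge_of_tendsto hq.norm (Eventually.of_forall fun n => by
    simpa using hφε (ψ n))
  obtain ⟨n₀, hn₀⟩ := Metric.tendsto_atTop.1 hq (ε / 2) (by positivity)
  obtain ⟨M, hM⟩ := he (ε / (4 * (‖R‖ + 1))) (by positivity)
  let g : ℕ ↪ ℕ := ⟨fun n => φ (ψ (n₀ + n)), fun a b hab => by
    simpa using hψ.injective (hφ.injective hab)⟩
  have h1 := hM ((Finset.range (M + 1)).map g) (by simp)
  rw [Finset.card_map, Finset.card_range, Finset.sum_map] at h1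
  have h2 : ‖∑ n ∈ Finset.range (M + 1), (R (e (g n)) - q)‖ ≤ (M + 1 : ℕ) * (ε / 2) := by
    refine (norm_sum_le_of_le _ (f := fun n => R (e (g n)) - q)
      (n := fun _ => ε / 2) fun n _ => ?_).trans_eq (by simp)
    have h4 := hn₀ (n₀ + n) (Nat.le_add_right _ _)
    rw [dist_eq_norm] at h4
    exact h4.le
  have h3 : ((M + 1 : ℕ) : ℝ) * ‖q‖ ≤ ‖R (∑ n ∈ Finset.range (M + 1), e (g n))‖ +
      (M + 1 : ℕ) * (ε / 2) := by
    have h4 : ((M + 1 : ℕ) : ℝ) • q = R (∑ n ∈ Finset.range (M + 1), e (g n)) -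
        ∑ n ∈ Finset.range (M + 1), (R (e (g n)) - q) := by
      rw [Finset.sum_sub_distrib, map_sum, sub_sub_cancel, Finset.sum_const, Finset.card_range,
        Nat.cast_smul_eq_nsmul]
    have h5 := norm_sub_le (R (∑ n ∈ Finset.range (M + 1), e (g n)))
      (∑ n ∈ Finset.range (M + 1), (R (e (g n)) - q))
    rw [← h4, norm_smul, Real.norm_natCast] at h5
    linarith
  have h6 : ‖R (∑ n ∈ Finset.range (M + 1), e (g n))‖ ≤ (M + 1 : ℕ) * (ε / 4) := by
    refine (R.le_opNorm _).trans ((mul_le_mul_of_nonneg_left h1 (norm_nonneg _)).trans ?_)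
    have h7 : ‖R‖ * (ε / (4 * (‖R‖ + 1))) ≤ ε / 4 := by
      rw [← mul_div_assoc, div_le_div_iff₀ (by positivity) (by norm_num)]
      nlinarith [norm_nonneg R]
    rw [← mul_assoc, mul_comm (((M + 1 : ℕ) : ℝ))]
    exact mul_le_mul_of_nonneg_right h7 (Nat.cast_nonneg _)
  have hMpos : (0 : ℝ) < (M + 1 : ℕ) := by positivity
  have := mul_le_mul_of_nonneg_left hqε hMpos.le
  nlinarith

/-- Near a unit vector of a locally AMUC space there are no segments of fixed length in the unit
ball whose directions are asymptotically in every finite-codimensional subspace. -/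
theorem IsLocallyAMUC.false_of_segments {Y : Type*} [NormedAddCommGroup Y] [NormedSpace ℝ Y]
    (hY : IsLocallyAMUC Y) {y : Y} (hy : ‖y‖ = 1) {u : ℕ → Y} {c : ℝ} (hc : 0 < c)
    (hu : ∀ n, c ≤ ‖u n‖) (hp : ∀ n, ‖y + u n‖ ≤ 1) (hm : ∀ n, ‖y - u n‖ ≤ 1)
    (hE : ∀ E ∈ cof Y, Tendsto (fun n => ‖(Submodule.Quotient.mk (u n) : Y ⧸ E)‖) atTop (𝓝 0)) :
    False := by
  have h1 := hY y hy (c / 2) (by positivity)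
  rw [amucModulus, EReal.sub_pos, lt_iSup_iff] at h1
  obtain ⟨E, h1⟩ := h1
  rw [lt_iSup_iff] at h1
  obtain ⟨hEc, h1⟩ := h1
  obtain ⟨q, hq1, hq⟩ := EReal.lt_iff_exists_real_btwn.1 h1
  have hq1' : 1 < q := by exact_mod_cast hq1
  have hq' : ∀ z ∈ E, ‖z‖ = 1 → q < max ‖y + (c / 2) • z‖ ‖y - (c / 2) • z‖ := by
    intro z hz hz1
    have := hq.trans_le (iInf₂_le z ⟨hz, hz1⟩)
    exact_mod_cast this
  -- Moving `u n` into `E` by less than ε keeps the endpoints in the ball of radius `q` and the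
  -- length at least c/2.
  set ε := min (q - 1) (c / 2) with hε
  have hε0 : 0 < ε := lt_min (by linarith) (by positivity)
  have hεq : ε ≤ q - 1 := min_le_left _ _
  have hεc : ε ≤ c / 2 := min_le_right _ _
  obtain ⟨n, hn⟩ := ((hE E hEc).eventually_lt_const hε0).exists
  obtain ⟨w, hw, hwε⟩ := (QuotientAddGroup.norm_lt_iff (S := E.toAddSubgroup)).1 hn
  have hz : u n - w ∈ E := (Submodule.Quotient.eq E).1 hw.symm
  set z := u n - w with hzdef
  have hzc : c / 2 ≤ ‖z‖ := by
    have := norm_sub_norm_le (u n) w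
    have := hu n
    linarith
  have hz0 : 0 < ‖z‖ := lt_of_lt_of_le (by positivity) hzc
  have h2 : ‖y + z‖ ≤ q := by
    rw [hzdef, ← add_sub_assoc]
    have := norm_sub_le (y + u n) w
    have := hp n
    linarith
  have h3 : ‖y - z‖ ≤ q := by
    rw [hzdef, ← sub_add]
    have := norm_add_le (y - u n) w
    have := hm n
    linarith
  -- Shrinking `z` to length exactly c/2 stays in the ball of radius `q` by convexity, as ‖y‖ = 1 <
  -- q.
  set θ := c / 2 * ‖z‖⁻¹ with hθ
  have hθ0 : 0 ≤ θ := by positivity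
  have hθ1 : θ ≤ 1 := by rw [hθ, ← div_eq_mul_inv]; exact div_le_one_of_le₀ hzc hz0.le
  have hconv : ∀ v : Y, ‖y + v‖ ≤ q → ‖y + θ • v‖ ≤ q := by
    intro v hv
    have h4 : y + θ • v = (1 - θ) • y + θ • (y + v) := by
      rw [sub_smul, one_smul, smul_add]; abel
    rw [h4]
    refine (norm_add_le _ _).trans ?_
    rw [norm_smul, norm_smul, hy, Real.norm_of_nonneg hθ0, Real.norm_of_nonneg (by linarith)]
    nlinarith
  have h4 := hq' (‖z‖⁻¹ • z) (E.smul_mem _ hz) (by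
    rw [norm_smul, norm_inv, norm_norm, inv_mul_cancel₀ hz0.ne'])
  rw [smul_smul, ← hθ] at h4
  refine absurd h4 (not_lt.2 (max_le (hconv z h2) ?_))
  have := hconv (-z) (by rwa [← sub_eq_add_neg])
  rwa [smul_neg, ← sub_eq_add_neg] at this

theorem IsLocallyAMUC.exists_norm_map_lt {X Y : Type*} [NormedAddCommGroup X] [NormedSpace ℝ X]
    [NormedAddCommGroup Y] [NormedSpace ℝ Y] (hY : IsLocallyAMUC Y) {S : X →L[ℝ] Y}
    (hS : S ∈ normAttaining X Y) {e : ℕ → X} {C : ℝ} (hC : ∀ n, ‖e n‖ ≤ C)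
    (he : ∀ η > 0, ∃ M : ℕ, ∀ F : Finset ℕ, M ≤ F.card → ‖∑ n ∈ F, e n‖ ≤ η * F.card)
    (hflat : ∀ x : X, ‖x‖ ≤ 1 → ∃ δ > 0, ∃ N : ℕ, ∀ n ≥ N, ∀ s : ℝ, |s| ≤ δ →
      ‖x + s • e n‖ ≤ 1) {c : ℝ} (hc : 0 < c) : ∃ n, ‖S (e n)‖ < c := by
  by_contra! H
  have hS0 : 0 < ‖S‖ := by
    rw [norm_pos_iff]
    rintro rfl
    have := H 0
    simp only [zero_apply, norm_zero] at this
    linarith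
  obtain ⟨x, hx1, hx⟩ := hS
  obtain ⟨δ, hδ, N, hN⟩ := hflat x hx1
  have hseg : ∀ n, ∀ s : ℝ, |s| ≤ δ →
      ‖‖S‖⁻¹ • S x + (s / ‖S‖) • S (e (n + N))‖ ≤ 1 := by
    intro n s hs
    have h1 : ‖S‖⁻¹ • S x + (s / ‖S‖) • S (e (n + N)) = ‖S‖⁻¹ • S (x + s • e (n + N)) := by
      rw [map_add, map_smul, smul_add, smul_smul, div_eq_inv_mul]
    rw [h1, norm_smul, norm_inv, norm_norm, inv_mul_le_iff₀ hS0, mul_one]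
    refine (S.le_opNorm _).trans ?_
    exact mul_le_of_le_one_right hS0.le (hN (n + N) (by omega) s hs)
  refine hY.false_of_segments (y := ‖S‖⁻¹ • S x) (u := fun n => (δ / ‖S‖) • S (e (n + N)))
    (c := δ / ‖S‖ * c) ?_ (by positivity) (fun n => ?_) (fun n => ?_) (fun n => ?_)
    (fun E hE => ?_)
  · rw [norm_smul, hx, norm_inv, norm_norm, inv_mul_cancel₀ hS0.ne']
  · rw [norm_smul, Real.norm_of_nonneg (by positivity)]
    exact mul_le_mul_of_nonneg_left (H _) (by positivity)
  · exact hseg n δ (abs_of_pos hδ).le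
  · have := hseg n (-δ) (by rw [abs_neg, abs_of_pos hδ])
    rwa [neg_div, neg_smul, ← sub_eq_add_neg] at this
  · obtain ⟨hcl, hfd⟩ := hE
    have : IsClosed (E : Set Y) := hcl
    let R : X →L[ℝ] Y ⧸ E := (δ / ‖S‖) • (E.mkQL.comp S)
    have h1 := tendsto_map_zero_of_small_averages R hC he
    have h2 := (h1.comp (tendsto_add_atTop_nat N)).norm
    rw [norm_zero] at h2
    exact h2

/-! ### Conclusion. -/

theorem mainTheorem3 (Y : Type u) [NormedAddCommGroup Y] [NormedSpace ℝ Y] [CompleteSpace Y]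
    (hY : IsLocallyAMUC Y)
    (hseq : ∃ y : ℕ → Y, (∀ n, ‖y n‖ = 1) ∧ IsSymmetricBasicSequence y ∧
      ¬ EquivSeq y l1UnitVector) :
    ¬ HasPropertyB.{u, v} Y := by
  intro hB
  obtain ⟨y, hy, hsym, hl⟩ := hseq
  obtain ⟨z, hz, hzF⟩ := exists_seq_small_averages y hy hsym hl
  obtain ⟨r, hr', hr0, hlim, hzr⟩ := exists_rate z (fun n => (hz n).le) hzF
  have hr := hr'.antitone
  -- The index set is lifted to universe `v`, where property B is tested.
  let e := flatVec.{v} hr hr0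
  have : CompleteSpace (closedSpan e) :=
    (Submodule.isClosed_topologicalClosure (Submodule.span ℝ (Set.range e))).completeSpace_coe
  obtain ⟨T, hT⟩ := exists_operator_flatVec.{v} hr hr0 hzr
  -- As ‖e n‖ ≤ r 0, this distance gives ‖(T - S) (e n)‖ ≤ 1/2, incompatible with ‖T (e n)‖ = 1 and
  -- ‖S (e n)‖ < 1/2.
  have hpos : 0 < 1 / (2 * r 0) := by have := hr0 0; positivity
  obtain ⟨S, hS, hTS⟩ := (hB (closedSpan e)).exists_dist_lt T hpos
  have hnorm : ∀ n, ‖toClosedSpan e n‖ ≤ r 0 := fun n => norm_flatVec_le hr hr0 n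
  obtain ⟨n, hn⟩ := hY.exists_norm_map_lt hS (e := toClosedSpan e) hnorm (fun η hη => by
      obtain ⟨M, hM⟩ := exists_norm_sum_flatVec_le.{v} hr hr0 hlim hη
      refine ⟨M, fun F hF => ?_⟩
      have h1 := hM F hF
      have h2 : ((∑ n ∈ F, toClosedSpan e n : closedSpan e) :
          lp (fun _ : ULift.{v} (Finset ℕ) => ℝ) ⊤) = ∑ n ∈ F, e n := by
        simp [toClosedSpan]
      rw [← h2] at h1
      exact h1)
    (fun x hx => exists_norm_add_smul_flatVec_le_one hr hr0 hr' hlim x.2 hx)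
    (c := 1 / 2) (by norm_num)
  have h1 : ‖(T - S) (toClosedSpan e n)‖ ≤ 1 / 2 := by
    refine ((T - S).le_opNorm _).trans ?_
    rw [dist_eq_norm] at hTS
    refine (mul_le_mul hTS.le (hnorm n) (norm_nonneg _) hpos.le).trans_eq ?_
    have := (hr0 0).ne'
    field_simp
  rw [sub_apply, hT] at h1
  have h2 := norm_sub_norm_le (z n) (S (toClosedSpan e n))
  rw [hz] at h2
  linarith
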